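/- For every $k\ge 5$ there are plane triangulations $H_{3k}$ on $n=3k$ vertices with connected domination number $\gamma_c(H_{3k})=k=\frac n3$; in fact there are two different families of this kind. Here all graphs are finite and simple, a triangulation is a maximal planar graph (it is planar, and joining any two nonadjacent vertices by an edge makes it nonplanar), and $\gamma_c(G)$ is the smallest number of vertices in a set $S$ such that every vertex of $G$ is in $S$ or adjacent to a vertex of $S$ and such that $S$ induces a connected subgraph. Given a triangulation $G$ and a triangle $abc$ of $G$ that bounds a face in a planar embedding of $G$, gluing an octahedron on $abc$ means adding a new triangle $efg$ together with the edges $ae, af, bf, bg, ce, cg$. Given a triangulation $G$ on $9$ vertices and such a triangle $abc$, called its outer triangle, put $H_9=G$ and, for $k\ge 3$, let $H_{3(k+1)}$ be obtained from $H_{3k}$ by gluing an octahedron on the outer triangle; the new triangle $efg$ is the outer triangle of $H_{3(k+1)}$. (1) Let $A$ be the graph formed by three triangles $a_0a_1a_2$, $b_0b_1b_2$, $c_0c_1c_2$ together with the edges $a_ib_j$ and $b_ic_j$ for all $i\ne j$. Then $A$ is a triangulation on $9$ vertices, $\gamma_c(A)=2$, and $c_0c_1c_2$ bounds a face. Starting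 from $H_9=A$ with outer triangle $c_0c_1c_2$, for every $k\ge 5$ the graph $H_{3k}$ is a triangulation on $3k$ vertices with $\gamma_c(H_{3k})=k$. (2) Let $G_9$ be the graph obtained from the triangular prism by placing in each of its three quadrilateral faces a new vertex adjacent to the four vertices of that face. Then $G_9$ is a triangulation on $9$ vertices with $\gamma_c(G_9)=3$, and it has facial triangles. Starting from $H_9=G_9$ with any facial triangle as outer triangle, for every $k\ge 5$ the graph $H_{3k}$ is a triangulation on $3k$ vertices with $\gamma_c(H_{3k})=k$. (3) For every $k\ge 5$, no graph $H_{3k}$ from (2) is isomorphic to the graph $H_{3k}$ from (1). -/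

import Mathlib

/-! ### Connected domination -/

/-- Every vertex is in `S` or is adjacent to a vertex of `S`. -/
def IsDominatingSet {V : Type*} (G : SimpleGraph V) (S : Finset V) : Prop :=
  ∀ v, v ∈ S ∨ ∃ u ∈ S, G.Adj u v

/-- A dominating set whose induced subgraph is connected (in particular nonempty). -/
def IsConnectedDominatingSet {V : Type*} (G : SimpleGraph V) (S : Finset V) : Prop :=
  IsDominatingSet G S ∧ (G.induce (S : Set V)).Connected

/-- The connected domination number: the least size of a connected dominating set
(with value `0` exactly when there is no connected dominating set). -/
noncomputable def connectedDominationNumber {V : Type*} (G : SimpleGraph V) : ℕ :=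
  sInf {m | ∃ S : Finset V, IsConnectedDominatingSet G S ∧ S.card = m}

/-! ### Planar embeddings -/

/-- A rotation system of a graph: for every vertex, a cyclic order of the darts (oriented edges)
that leave it.  It is given as one permutation `rot` of the darts whose cycles are exactly the
sets of darts with a common initial vertex.  This is a cellular embedding of each component
that has an edge in a closed oriented surface. -/
structure RotationSystem {V : Type*} (G : SimpleGraph V) where
  /-- The next dart around the initial vertex. -/
  rot : Equiv.Perm G.Dart
  rot_fst : ∀ d, (rot d).fst = d.fst
  sameCycle : ∀ d d' : G.Dart, d.fst = d'.fst → rot.SameCycle d d'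

namespace RotationSystem

variable {V : Type*} {G : SimpleGraph V}

/-- Reversal of darts, as a permutation. -/
def flip (G : SimpleGraph V) : Equiv.Perm G.Dart where
  toFun := SimpleGraph.Dart.symm
  invFun := SimpleGraph.Dart.symm
  left_inv := SimpleGraph.Dart.symm_symm
  right_inv := SimpleGraph.Dart.symm_symm

/-- The face permutation: run along a dart `d` from `u` to `v`, then leave `v` along the dart that
follows the reverse of `d` in the rotation at `v`.  Its cycles are the boundary walks of faces. -/
def facePerm (R : RotationSystem G) : Equiv.Perm G.Dart :=
  (flip G).trans R.rot

/-- The number of faces, summed over the connected components of the graph: one for every cycle of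
the face permutation, and one for every isolated vertex (a point embedded in a sphere). -/
noncomputable def faceCount (R : RotationSystem G) : ℕ :=
  Nat.card (Quotient (Equiv.Perm.SameCycle.setoid R.facePerm)) +
    Nat.card {v : V // ∀ w, ¬ G.Adj v w}

/-- The rotation system embeds every component in the sphere.  As `V - E + F ≤ 2` holds for every
component, with equality exactly for the sphere, this says that the sum over all components is
twice their number. -/
def IsSpherical (R : RotationSystem G) : Prop :=
  Nat.card V + R.faceCount = Nat.card G.edgeSet + 2 * Nat.card G.ConnectedComponent

end RotationSystem

/-- A finite graph is planar if it has a (combinatorial) embedding in the sphere. -/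
def IsPlanar {V : Type*} [Finite V] (G : SimpleGraph V) : Prop :=
  ∃ R : RotationSystem G, R.IsSpherical

/-- A triangulation is a maximal planar graph: it is planar, and joining any two nonadjacent
vertices by a new edge gives a graph that is not planar. -/
def IsTriangulation {V : Type*} [Finite V] (G : SimpleGraph V) : Prop :=
  IsPlanar G ∧ ∀ u v, u ≠ v → ¬ G.Adj u v → ¬ IsPlanar (G ⊔ SimpleGraph.edge u v)

/-- The vertices `t 0`, `t 1`, `t 2` are the consecutive vertices of a triangle that bounds a face
in some planar embedding of `G`. -/
def IsFacialTriangle {V : Type*} [Finite V] (G : SimpleGraph V) (t : Fin 3 → V) : Prop :=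
  ∃ R : RotationSystem G, R.IsSpherical ∧ ∃ d : G.Dart,
    d.fst = t 0 ∧ (R.facePerm d).fst = t 1 ∧ (R.facePerm (R.facePerm d)).fst = t 2 ∧
      R.facePerm (R.facePerm (R.facePerm d)) = d

/-! ### Gluing octahedra -/

/-- Glue an octahedron on the triangle `t 0, t 1, t 2` of `G`: put in a new triangle with vertices
`inr 0, inr 1, inr 2`, and join `inr i` to `t j` for all `j ≠ i`.  The three old and the three new
vertices then carry an octahedron, in which `inr i` is opposite to `t i`. -/
def glueOctahedron {V : Type*} (G : SimpleGraph V) (t : Fin 3 → V) :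
    SimpleGraph (V ⊕ Fin 3) where
  Adj
    | .inl u, .inl v => G.Adj u v
    | .inl u, .inr i => ∃ j, j ≠ i ∧ u = t j
    | .inr i, .inl u => ∃ j, j ≠ i ∧ u = t j
    | .inr i, .inr j => i ≠ j
  symm := by
    constructor
    rintro (u | i) (v | j) h
    · exact SimpleGraph.Adj.symm (G := G) h
    · exact h
    · exact h
    · exact Ne.symm h
  loopless := by
    constructor
    rintro (u | i) h
    · exact G.irrefl h
    · exact h rfl

/-- The vertices after `m` gluing steps. -/
def TowerVertex (V : Type*) : ℕ → Type _
  | 0 => V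
  | m + 1 => TowerVertex V m ⊕ Fin 3

instance instFiniteTowerVertex (V : Type*) [Finite V] : (m : ℕ) → Finite (TowerVertex V m)
  | 0 => inferInstanceAs (Finite V)
  | m + 1 =>
    have := instFiniteTowerVertex V m
    inferInstanceAs (Finite (TowerVertex V m ⊕ Fin 3))

/-- The outer triangle after `m` gluing steps: the triangle `t` at first, afterwards the triangle
put in by the last step. -/
def outerTriangle {V : Type*} (t : Fin 3 → V) : (m : ℕ) → Fin 3 → TowerVertex V m
  | 0 => t
  | _ + 1 => Sum.inr

/-- The graph obtained from `G` by `m` successive gluings of an octahedron, the first one on the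
triangle `t` and each later one on the triangle put in by the step before it. -/
def octahedronTower {V : Type*} (G : SimpleGraph V) (t : Fin 3 → V) :
    (m : ℕ) → SimpleGraph (TowerVertex V m)
  | 0 => G
  | m + 1 => glueOctahedron (octahedronTower G t m) (outerTriangle t m)

/-! ### The two starting triangulations on nine vertices -/

/-- Three nested triangles `0 1 2`, `3 4 5`, `6 7 8`; the vertices with remainders `a` and `b`
modulo `3` in consecutive triangles are adjacent if and only if `a ≠ b`. -/
def nestedTriangles : SimpleGraph (Fin 9) :=
  SimpleGraph.fromRel fun i j =>
    i.val / 3 = j.val / 3 ∨ (i.val / 3 + 1 = j.val / 3 ∧ i.val % 3 ≠ j.val % 3)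

/-- The triangular prism on the triangles `0 1 2` and `3 4 5`, with a further vertex of degree four
(`6`, `7` and `8`) placed in each of its three quadrilateral faces. -/
def cappedPrism : SimpleGraph (Fin 9) :=
  SimpleGraph.fromRel fun i j => (i, j) ∈
    ([(0, 1), (0, 2), (1, 2), (3, 4), (3, 5), (4, 5), (0, 3), (1, 4), (2, 5),
      (6, 0), (6, 1), (6, 3), (6, 4), (7, 1), (7, 2), (7, 4), (7, 5),
      (8, 0), (8, 2), (8, 3), (8, 5)] : List (Fin 9 × Fin 9))

/-!
Planarity. In a connected graph with at least three vertices every face has length at least three,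
so Euler's formula gives `E ≤ 3 V - 6`, with equality exactly if all faces are triangles. Hence a
connected planar graph with `3 V - 6` edges is a triangulation, and its spherical rotation systems
are those whose face permutation has order three (`isSpherical_iff_facePerm`). This turns the
global condition of being spherical into a local one: a triangular embedding is encoded by an apex
map (`IsApexMap`), which sends a dart to the third vertex of the face on its left. Gluing an
octahedron into a face changes the apex map in an explicit way (`isApexMap_glueApex`) and adds
nine edges and three vertices, so the property persists along a tower. By the equality case above,
an arbitrary facial triangle of the starting graph is a face of some apex map.

Domination. A connected dominating set of the starting graph that has a vertex on the outer
triangle grows by one vertex in every gluing step, which gives the upper bound. For the lower bound,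
split the tower into levels, the starting graph being level `0`. A connected dominating set `S`
meets all levels from `0` up to the last but one; if it misses the last level, it has two vertices
on the level before. So `m ≥ 2` steps account for at least `m` vertices. On level `0` there are at
least three: the part of `S` there has to reach the outer triangle within itself, and in both
starting graphs one or two vertices that do so never dominate all vertices off the outer triangle
(`NoDominatingPair`, a finite check).

Isomorphism. All degrees of the first family are even. In the second family some vertex of the prism
lies off the outer triangle, and it keeps its degree five.
-/

/-! ### Face lengths and Euler's bound -/

namespace Equiv.Perm

variable {α : Type*}

/-- The representative of a cycle of `f` and its first two iterates. -/
noncomputable def firstThree (f : Perm α) (p : Quotient (SameCycle.setoid f) × Fin 3) : α :=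
  (f ^ (p.2 : ℕ)) p.1.out

theorem mk_firstThree (f : Perm α) (p : Quotient (SameCycle.setoid f) × Fin 3) :
    (Quotient.mk (SameCycle.setoid f) (firstThree f p)) = p.1 := by
  conv_rhs => rw [← p.1.out_eq]
  exact Quotient.sound ((sameCycle_pow_left (n := (p.2 : ℕ))).2 (SameCycle.refl f _))

/-- Without cycles of length one or two, the three iterates are distinct; counting them gives
`3 F ≤ 2 E` when `f` is a face permutation. -/
theorem firstThree_injective {f : Perm α} (h1 : ∀ x, f x ≠ x) (h2 : ∀ x, f (f x) ≠ x) :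
    Function.Injective (firstThree f) := by
  rintro ⟨q, i⟩ ⟨q', j⟩ h
  obtain rfl : q = q' := by
    have h' := congrArg (Quotient.mk (SameCycle.setoid f)) h
    rwa [mk_firstThree, mk_firstThree] at h'
  have h1' := h1 q.out
  have h2' := h2 q.out
  have h3' := h1 (f q.out)
  fin_cases i <;> fin_cases j <;> simp_all [firstThree, pow_two, eq_comm]

/-- Equality holds in that count exactly if all cycles have length three. -/
theorem firstThree_surjective_iff {f : Perm α} (h1 : ∀ x, f x ≠ x) (h2 : ∀ x, f (f x) ≠ x) :
    Function.Surjective (firstThree f) ↔ ∀ x, f (f (f x)) = x := by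
  constructor
  · intro hs
    have key (q : Quotient (SameCycle.setoid f)) : f (f (f q.out)) = q.out := by
      obtain ⟨⟨q', i⟩, h⟩ := hs (f (f (f q.out)))
      obtain rfl : q' = q := by
        have h' := congrArg (Quotient.mk (SameCycle.setoid f)) h
        refine ((mk_firstThree f (q', i)).symm.trans h').trans ?_
        conv_rhs => rw [← q.out_eq]
        exact Quotient.sound ((sameCycle_pow_left (n := 3)).2 (SameCycle.refl f _))
      have h1' := h1 q'.out
      have h2' := h2 q'.out
      have h3' := h1 (f q'.out)
      fin_cases i
      · exact h.symm
      · exact absurd (f.injective h).symm h2'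
      · exact absurd (f.injective (f.injective h)).symm h1'
    intro x
    obtain ⟨⟨q, i⟩, rfl⟩ := hs x
    have hq := key q
    fin_cases i <;> simp_all [firstThree, pow_two]
  · intro h3 x
    have hx : SameCycle f (Quotient.mk (SameCycle.setoid f) x).out x :=
      Quotient.exact (Quotient.out_eq (Quotient.mk (SameCycle.setoid f) x))
    obtain ⟨n, hn⟩ := hx
    have h3' : f ^ (3 : ℤ) = 1 := by
      ext y
      exact h3 y
    refine ⟨(Quotient.mk _ x, ⟨(n % 3).toNat, by omega⟩), ?_⟩
    have hz : f ^ (n % 3).toNat = f ^ n := by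
      rw [← zpow_natCast, Int.toNat_of_nonneg (by omega), ← zpow_eq_zpow_emod n h3']
    exact (congrArg (fun g : Perm α => g _) hz).trans hn

end Equiv.Perm

namespace RotationSystem

variable {V : Type*} {G : SimpleGraph V} (R : RotationSystem G)

theorem facePerm_fst (d : G.Dart) : (R.facePerm d).fst = d.snd :=
  R.rot_fst d.symm

theorem facePerm_ne (d : G.Dart) : R.facePerm d ≠ d := fun h =>
  d.adj.ne (by rw [← R.facePerm_fst d, h])

/-- If the rotation fixes a dart, then its initial vertex has degree one. -/
theorem eq_of_rot_eq {d e : G.Dart} (hd : R.rot d = d) (he : e.fst = d.fst) : e = d := by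
  obtain ⟨n, rfl⟩ := R.sameCycle d e he.symm
  exact Equiv.Perm.zpow_apply_eq_self_of_apply_eq_self hd n

/-- A face of length two only occurs if the graph is a single edge. -/
theorem facePerm_facePerm_ne [Finite V] (hG : G.Connected) (h3 : 3 ≤ Nat.card V) (d : G.Dart) :
    R.facePerm (R.facePerm d) ≠ d := by
  intro h
  have hs : R.facePerm d = d.symm := by
    have h1 := R.facePerm_fst (R.facePerm d)
    rw [h] at h1
    exact SimpleGraph.Dart.ext _ _ (Prod.ext (R.facePerm_fst d) h1.symm)
  have r1 : R.rot d.symm = d.symm := hs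
  have r2 : R.rot d = d := by
    rw [hs] at h
    exact h
  have hall : ∀ v, v = d.fst ∨ v = d.snd := by
    intro v
    have hr := hG.preconnected d.fst v
    rw [SimpleGraph.reachable_iff_reflTransGen] at hr
    induction hr with
    | refl => exact Or.inl rfl
    | @tail b c _ hbc ih =>
      rcases ih with rfl | rfl
      · right
        exact congrArg (fun e : G.Dart => e.snd) (R.eq_of_rot_eq (e := ⟨(_, c), hbc⟩) r2 rfl)
      · left
        exact congrArg (fun e : G.Dart => e.snd) (R.eq_of_rot_eq (e := ⟨(_, c), hbc⟩) r1 rfl)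
  have hle : Nat.card V ≤ 2 := by
    have hu : (Set.univ : Set V) = {d.fst, d.snd} := by
      ext v
      simpa using hall v
    rw [← Set.ncard_univ, hu]
    exact (Set.ncard_insert_le _ _).trans (by simp)
  omega

theorem faceCount_eq [Finite V] (hG : G.Connected) (h3 : 3 ≤ Nat.card V) :
    R.faceCount = Nat.card (Quotient (Equiv.Perm.SameCycle.setoid R.facePerm)) := by
  have : Nontrivial V := Finite.one_lt_card_iff_nontrivial.1 (by omega)
  have : IsEmpty {v : V // ∀ w, ¬ G.Adj v w} := by
    refine ⟨fun ⟨v, hv⟩ => ?_⟩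
    obtain ⟨w, hw⟩ := hG.preconnected.exists_adj_of_nontrivial v
    exact hv w hw
  simp [faceCount]

theorem isSpherical_iff [Finite V] (hG : G.Connected) (h3 : 3 ≤ Nat.card V) :
    R.IsSpherical ↔ Nat.card V + Nat.card (Quotient (Equiv.Perm.SameCycle.setoid R.facePerm)) =
      Nat.card G.edgeSet + 2 := by
  have : Nat.card G.ConnectedComponent = 1 := by
    have := hG.preconnected.subsingleton_connectedComponent
    have := hG.nonempty
    exact Nat.card_of_subsingleton (G.connectedComponentMk (Classical.arbitrary V))
  rw [IsSpherical, R.faceCount_eq hG h3, this]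

instance [Finite V] : Finite G.Dart :=
  Finite.of_injective SimpleGraph.Dart.toProd SimpleGraph.Dart.toProd_injective

theorem _root_.SimpleGraph.natCard_dart [Finite V] :
    Nat.card G.Dart = 2 * Nat.card G.edgeSet := by
  classical
  have := Fintype.ofFinite V
  rw [Nat.card_eq_fintype_card, G.dart_card_eq_twice_card_edges, Nat.card_eq_fintype_card,
    SimpleGraph.edgeFinset_card]

theorem three_mul_card_faces_le [Finite V] (hG : G.Connected) (h3 : 3 ≤ Nat.card V) :
    3 * Nat.card (Quotient (Equiv.Perm.SameCycle.setoid R.facePerm)) ≤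
      2 * Nat.card G.edgeSet := by
  have := Nat.card_le_card_of_injective _
    (Equiv.Perm.firstThree_injective R.facePerm_ne (R.facePerm_facePerm_ne hG h3))
  rw [Nat.card_prod, Nat.card_fin, SimpleGraph.natCard_dart] at this
  omega

theorem three_mul_card_faces_eq_iff [Finite V] (hG : G.Connected) (h3 : 3 ≤ Nat.card V) :
    3 * Nat.card (Quotient (Equiv.Perm.SameCycle.setoid R.facePerm)) = 2 * Nat.card G.edgeSet ↔
      ∀ d, R.facePerm (R.facePerm (R.facePerm d)) = d := by
  have hinj := Equiv.Perm.firstThree_injective R.facePerm_ne (R.facePerm_facePerm_ne hG h3)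
  rw [← Equiv.Perm.firstThree_surjective_iff R.facePerm_ne (R.facePerm_facePerm_ne hG h3),
    ← SimpleGraph.natCard_dart]
  have hcard : Nat.card (Quotient (Equiv.Perm.SameCycle.setoid R.facePerm) × Fin 3) =
      3 * Nat.card (Quotient (Equiv.Perm.SameCycle.setoid R.facePerm)) := by
    rw [Nat.card_prod, Nat.card_fin, mul_comm]
  rw [← hcard]
  constructor
  · intro h
    exact (hinj.bijective_of_nat_card_le h.ge).2
  · intro h
    exact Nat.card_eq_of_bijective _ ⟨hinj, h⟩

/-- Euler's bound `E ≤ 3 V - 6`. -/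
theorem IsSpherical.card_edgeSet_le [Finite V] {R : RotationSystem G} (hR : R.IsSpherical)
    (hG : G.Connected) (h3 : 3 ≤ Nat.card V) : Nat.card G.edgeSet + 6 ≤ 3 * Nat.card V := by
  have h1 := (R.isSpherical_iff hG h3).1 hR
  have h2 := R.three_mul_card_faces_le hG h3
  omega

/-- In a graph with `3 V - 6` edges, the spherical rotation systems are exactly those all of whose
faces are triangles. -/
theorem isSpherical_iff_facePerm [Finite V] (hG : G.Connected) (h3 : 3 ≤ Nat.card V)
    (hE : Nat.card G.edgeSet + 6 = 3 * Nat.card V) :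
    R.IsSpherical ↔ ∀ d, R.facePerm (R.facePerm (R.facePerm d)) = d := by
  rw [R.isSpherical_iff hG h3, ← R.three_mul_card_faces_eq_iff hG h3]
  omega

end RotationSystem

/-- One more edge would violate Euler's bound. -/
theorem isTriangulation_of_card_edgeSet {V : Type*} [Finite V] {G : SimpleGraph V}
    (hG : G.Connected) (h3 : 3 ≤ Nat.card V) (hE : Nat.card G.edgeSet + 6 = 3 * Nat.card V)
    (hP : IsPlanar G) : IsTriangulation G := by
  refine ⟨hP, fun u v huv hadj ⟨R, hR⟩ => ?_⟩
  have hle := hR.card_edgeSet_le (hG.mono le_sup_left) h3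
  have hcard : Nat.card (G ⊔ SimpleGraph.edge u v).edgeSet = Nat.card G.edgeSet + 1 := by
    rw [SimpleGraph.edgeSet_sup, SimpleGraph.edgeSet_edge_of_ne huv, Set.union_singleton]
    exact Set.ncard_insert_of_notMem hadj
  omega

/-! ### Triangular embeddings as apex maps -/

/-- The rotation at `v` of the triangular embedding with apex map `θ`: the neighbour `a` is
followed by the apex of the face on the left of the dart from `a` to `v`. -/
def LinkStep {V : Type*} (θ : V → V → V) (v a b : V) : Prop :=
  b = θ a v

theorem linkStep_path {V : Type*} {θ : V → V → V} {v a b : V} (h : θ a v = b) :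
    Relation.ReflTransGen (LinkStep θ v) a b :=
  .single h.symm

/-- A triangular embedding of `G`, given by the third vertex `θ u v` of the face on the left of
each dart from `u` to `v`.  By `link`, the rotation at a vertex runs through all its neighbours.
The values of `θ` at nonadjacent vertices are irrelevant. -/
structure IsApexMap {V : Type*} (G : SimpleGraph V) (θ : V → V → V) : Prop where
  adj : ∀ u v, G.Adj u v → G.Adj v (θ u v)
  apex : ∀ u v, G.Adj u v → θ v (θ u v) = u
  link : ∀ v w w', G.Adj v w → G.Adj v w' → Relation.ReflTransGen (LinkStep θ v) w w'

/-- The triangle `t 0, t 1, t 2` bounds a face, traversed in this order, of the embedding given by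
the apex map `θ`. -/
def IsApexFace {V : Type*} (G : SimpleGraph V) (θ : V → V → V) (t : Fin 3 → V) : Prop :=
  ∀ i, G.Adj (t i) (t (i + 1)) ∧ θ (t i) (t (i + 1)) = t (i + 2)

theorem IsApexFace.injective {V : Type*} {G : SimpleGraph V} {θ : V → V → V} {t : Fin 3 → V}
    (ht : IsApexFace G θ t) : Function.Injective t := by
  intro i j h
  have h1 := (ht i).1.ne
  have h2 := (ht j).1.ne
  have hij : j = i ∨ j = i + 1 ∨ i = j + 1 := by
    clear h h1 h2
    revert i j
    decide
  rcases hij with rfl | rfl | rfl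
  · rfl
  · exact absurd h h1
  · exact absurd h.symm h2

namespace IsApexMap

variable {V : Type*} {G : SimpleGraph V} {θ : V → V → V}

/-- One step along the boundary of a face. -/
def faceStep (hθ : IsApexMap G θ) (d : G.Dart) : G.Dart :=
  ⟨(d.snd, θ d.fst d.snd), hθ.adj _ _ d.adj⟩

theorem faceStep_faceStep_faceStep (hθ : IsApexMap G θ) (d : G.Dart) :
    hθ.faceStep (hθ.faceStep (hθ.faceStep d)) = d := by
  have h1 := hθ.apex _ _ d.adj
  have h2 := hθ.apex _ _ (hθ.adj _ _ d.adj)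
  refine SimpleGraph.Dart.ext _ _ (Prod.ext h1 ?_)
  simpa only [faceStep, h1] using h2

/-- The face permutation of the triangular embedding. -/
def facePerm (hθ : IsApexMap G θ) : Equiv.Perm G.Dart where
  toFun := hθ.faceStep
  invFun d := hθ.faceStep (hθ.faceStep d)
  left_inv := hθ.faceStep_faceStep_faceStep
  right_inv := hθ.faceStep_faceStep_faceStep

/-- The rotation system of an apex map. -/
def rotationSystem (hθ : IsApexMap G θ) : RotationSystem G where
  rot := (RotationSystem.flip G).trans hθ.facePerm
  rot_fst _ := rfl
  sameCycle := by
    rintro ⟨⟨v, w⟩, h⟩ ⟨⟨v', w'⟩, h'⟩ rfl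
    have key : ∀ x, Relation.ReflTransGen (LinkStep θ v) w x → ∃ hx : G.Adj v x,
        Equiv.Perm.SameCycle ((RotationSystem.flip G).trans hθ.facePerm)
          ⟨(v, w), h⟩ ⟨(v, x), hx⟩ := by
      intro x hx
      induction hx with
      | refl => exact ⟨h, Equiv.Perm.SameCycle.refl _ _⟩
      | @tail b c _ hbc ih =>
        obtain ⟨hb, hs⟩ := ih
        subst hbc
        exact ⟨hθ.adj _ _ hb.symm, Equiv.Perm.sameCycle_apply_right.2 hs⟩
    exact (key w' (hθ.link v w w' h h')).2

end IsApexMap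

/-- A connected graph with `3 V - 6` edges and a triangular embedding in which the triangle `t`
bounds a face. -/
structure HasTriangularEmbedding {V : Type*} (G : SimpleGraph V) (t : Fin 3 → V) : Prop where
  connected : G.Connected
  card_edgeSet : Nat.card G.edgeSet + 6 = 3 * Nat.card V
  exists_apexMap : ∃ θ, IsApexMap G θ ∧ IsApexFace G θ t

theorem SimpleGraph.three_le_natCard_of_card_edgeSet {V : Type*} [Finite V] {G : SimpleGraph V}
    {u v : V} (huv : G.Adj u v) (hE : Nat.card G.edgeSet + 6 = 3 * Nat.card V) :
    3 ≤ Nat.card V := by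
  have : Nonempty G.edgeSet := ⟨⟨s(u, v), huv⟩⟩
  have : 0 < Nat.card G.edgeSet := Nat.card_pos
  omega

namespace HasTriangularEmbedding

variable {V : Type*} [Finite V] {G : SimpleGraph V} {t : Fin 3 → V}

theorem three_le_natCard (h : HasTriangularEmbedding G t) : 3 ≤ Nat.card V := by
  obtain ⟨θ, -, ht⟩ := h.exists_apexMap
  exact SimpleGraph.three_le_natCard_of_card_edgeSet (ht 0).1 h.card_edgeSet

theorem isFacialTriangle (h : HasTriangularEmbedding G t) : IsFacialTriangle G t := by
  obtain ⟨θ, hθ, ht⟩ := h.exists_apexMap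
  refine ⟨hθ.rotationSystem, ?_, ⟨(t 0, t 1), (ht 0).1⟩, rfl, rfl, (ht 0).2,
    hθ.faceStep_faceStep_faceStep _⟩
  exact (hθ.rotationSystem.isSpherical_iff_facePerm h.connected h.three_le_natCard
    h.card_edgeSet).2 hθ.faceStep_faceStep_faceStep

theorem isTriangulation (h : HasTriangularEmbedding G t) : IsTriangulation G :=
  isTriangulation_of_card_edgeSet h.connected h.three_le_natCard h.card_edgeSet
    (h.isFacialTriangle.imp fun _ hR => hR.1)

end HasTriangularEmbedding

open Classical in
/-- The apex map of a rotation system. -/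
noncomputable def RotationSystem.apexMap {V : Type*} {G : SimpleGraph V} (R : RotationSystem G)
    (u v : V) : V :=
  if h : G.Adj u v then (R.facePerm ⟨(u, v), h⟩).snd else u

theorem RotationSystem.apexMap_dart {V : Type*} {G : SimpleGraph V} (R : RotationSystem G)
    (d : G.Dart) : R.apexMap d.fst d.snd = (R.facePerm d).snd :=
  dif_pos d.adj

/-- As all faces of a graph with `3 V - 6` edges are triangles, every facial triangle is a face
of a triangular embedding. -/
theorem IsFacialTriangle.hasTriangularEmbedding {V : Type*} [Finite V] {G : SimpleGraph V}
    {t : Fin 3 → V} (ht : IsFacialTriangle G t) (hG : G.Connected)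
    (hE : Nat.card G.edgeSet + 6 = 3 * Nat.card V) : HasTriangularEmbedding G t := by
  obtain ⟨R, hR, d, h0, h1, h2, h3⟩ := ht
  have hf := (R.isSpherical_iff_facePerm hG
    (SimpleGraph.three_le_natCard_of_card_edgeSet d.adj hE) hE).1 hR
  have hstep (d : G.Dart) : (R.facePerm d).fst = d.snd := R.facePerm_fst d
  refine ⟨hG, hE, R.apexMap, ⟨fun u v h => ?_, fun u v h => ?_, fun v w w' h h' => ?_⟩, ?_⟩
  · rw [R.apexMap_dart ⟨(u, v), h⟩]
    have := (R.facePerm ⟨(u, v), h⟩).adj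
    rwa [hstep] at this
  · have e1 := R.apexMap_dart (R.facePerm ⟨(u, v), h⟩)
    have e2 := hstep (R.facePerm (R.facePerm ⟨(u, v), h⟩))
    rw [hf] at e2
    rw [hstep, ← R.apexMap_dart ⟨(u, v), h⟩, ← e2] at e1
    exact e1
  · obtain ⟨n, -, hn⟩ := (R.sameCycle ⟨(v, w), h⟩ ⟨(v, w'), h'⟩ rfl).exists_pow_eq'
    have key (n : ℕ) : ((R.rot ^ n) ⟨(v, w), h⟩).fst = v ∧ Relation.ReflTransGen
        (LinkStep R.apexMap v) w ((R.rot ^ n) ⟨(v, w), h⟩).snd := by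
      induction n with
      | zero => exact ⟨rfl, Relation.ReflTransGen.refl⟩
      | succ n ih =>
        rw [pow_succ', Equiv.Perm.mul_apply]
        refine ⟨(R.rot_fst _).trans ih.1, ih.2.tail ?_⟩
        have e := R.apexMap_dart ((R.rot ^ n) ⟨(v, w), h⟩).symm
        have hr (d : G.Dart) : R.facePerm d.symm = R.rot d :=
          congrArg R.rot d.symm_symm
        rw [hr] at e
        exact e.symm.trans (congrArg (R.apexMap _) ih.1)
    have := (key n).2
    rwa [hn] at this
  · have e0 := R.apexMap_dart d
    have e1 := R.apexMap_dart (R.facePerm d)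
    have e2 := R.apexMap_dart (R.facePerm (R.facePerm d))
    have a0 := d.adj
    have a1 := (R.facePerm d).adj
    have a2 := (R.facePerm (R.facePerm d)).adj
    rw [← hstep, h0, h1] at e0 a0
    rw [← hstep, h1, h2] at e1 a1
    rw [← hstep, h3, h0, h2] at e2 a2
    rw [← hstep, h2] at e0
    rw [← hstep, h3, h0] at e1
    rw [← hstep, h1] at e2
    intro i
    fin_cases i
    · exact ⟨a0, e0⟩
    · exact ⟨a1, e1⟩
    · exact ⟨a2, e2⟩

/-! ### Gluing an octahedron -/

theorem Fin.eq_add_of_ne {i j : Fin 3} (h : j ≠ i) : j = i + 1 ∨ j = i + 2 := by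
  revert i j; decide

section Glue

variable {V : Type*} {G : SimpleGraph V} {t : Fin 3 → V}

open Classical in
/-- The apex map after an octahedron is glued into the face `t` of the embedding `θ`: the new
vertex `inr i` lies between `t (i + 1)` and `t (i + 2)`, opposite to `t i`. -/
noncomputable def glueApex (θ : V → V → V) (t : Fin 3 → V) : V ⊕ Fin 3 → V ⊕ Fin 3 → V ⊕ Fin 3
  | .inl u, .inl v => if h : ∃ i, u = t i ∧ v = t (i + 1) then .inr (h.choose + 2)
      else .inl (θ u v)
  | .inl u, .inr k => if u = t (k + 2) then .inl (t (k + 1)) else .inr (k + 2)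
  | .inr k, .inl u => if u = t (k + 1) then .inl (t (k + 2)) else .inr (k + 1)
  | .inr k, .inr l => if l = k + 1 then .inr (k + 2) else .inl (t (k + 1))

theorem glueApex_face (θ : V → V → V) (ht : Function.Injective t) (i : Fin 3) :
    glueApex θ t (.inl (t i)) (.inl (t (i + 1))) = .inr (i + 2) := by
  have h : ∃ j, t i = t j ∧ t (i + 1) = t (j + 1) := ⟨i, rfl, rfl⟩
  rw [glueApex, dif_pos h, ← ht h.choose_spec.1]

theorem glueApex_inl {θ : V → V → V} {u v : V} (h : ¬ ∃ i, u = t i ∧ v = t (i + 1)) :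
    glueApex θ t (.inl u) (.inl v) = .inl (θ u v) := by
  rw [glueApex, dif_neg h]

theorem glueApex_inl_inr_left (θ : V → V → V) (k : Fin 3) :
    glueApex θ t (.inl (t (k + 2))) (.inr k) = .inl (t (k + 1)) := by
  simp [glueApex]

theorem glueApex_inl_inr_right (θ : V → V → V) (ht : Function.Injective t) (k : Fin 3) :
    glueApex θ t (.inl (t (k + 1))) (.inr k) = .inr (k + 2) := by
  simp [glueApex, ht.eq_iff]

theorem glueApex_inr_inl_left (θ : V → V → V) (k : Fin 3) :
    glueApex θ t (.inr k) (.inl (t (k + 1))) = .inl (t (k + 2)) := by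
  simp [glueApex]

theorem glueApex_inr_inl_right (θ : V → V → V) (ht : Function.Injective t) (k : Fin 3) :
    glueApex θ t (.inr k) (.inl (t (k + 2))) = .inr (k + 1) := by
  simp [glueApex, ht.eq_iff]

theorem glueApex_inr_inr_left (θ : V → V → V) (k : Fin 3) :
    glueApex θ t (.inr k) (.inr (k + 1)) = .inr (k + 2) := by
  simp [glueApex]

theorem glueApex_inr_inr_right (θ : V → V → V) (k : Fin 3) :
    glueApex θ t (.inr k) (.inr (k + 2)) = .inl (t (k + 1)) := by
  simp [glueApex]

theorem Fin.three_add (k : Fin 3) : k + 1 + 1 = k + 2 ∧ k + 1 + 2 = k ∧ k + 2 + 1 = k ∧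
    k + 2 + 2 = k + 1 := by
  revert k; decide

/-- The new vertices are inserted in the rotation at `v` between consecutive old neighbours. -/
theorem glueApex_link_inl {θ : V → V → V} (ht : IsApexFace G θ t) {v w w' : V}
    (h : Relation.ReflTransGen (LinkStep θ v) w w') :
    Relation.ReflTransGen (LinkStep (glueApex θ t) (.inl v)) (.inl w) (.inl w') := by
  refine h.lift' Sum.inl fun a b hab => ?_
  subst hab
  by_cases hi : ∃ i, a = t i ∧ v = t (i + 1)
  · obtain ⟨i, rfl, rfl⟩ := hi
    obtain ⟨h11, h12, h21, h22⟩ := Fin.three_add i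
    have h1 := glueApex_inr_inl_right θ ht.injective (i + 2)
    have h2 := glueApex_inr_inl_left θ (t := t) i
    rw [h22, h21] at h1
    rw [← (ht i).2] at h2
    exact ((linkStep_path (glueApex_face θ ht.injective i)).trans (linkStep_path h1)).trans
      (linkStep_path h2)
  · exact linkStep_path (glueApex_inl hi)

/-- The new vertices divide the face `t` into seven triangles. -/
theorem isApexMap_glueApex {θ : V → V → V} (hθ : IsApexMap G θ) (ht : IsApexFace G θ t) :
    IsApexMap (glueOctahedron G t) (glueApex θ t) := by
  have hinj := ht.injective
  have hne (k : Fin 3) : k + 1 ≠ k ∧ k + 2 ≠ k ∧ k ≠ k + 1 ∧ k ≠ k + 2 := by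
    revert k; decide
  have hne' (k : Fin 3) : k + 1 ≠ k + 2 ∧ k + 2 ≠ k + 1 := by
    revert k; decide
  have hboth : ∀ x y, (glueOctahedron G t).Adj x y →
      (glueOctahedron G t).Adj y (glueApex θ t x y) ∧ glueApex θ t y (glueApex θ t x y) = x := by
    rintro (u | k) (v | l) h
    · by_cases hi : ∃ i, u = t i ∧ v = t (i + 1)
      · obtain ⟨i, rfl, rfl⟩ := hi
        obtain ⟨h11, h12, h21, h22⟩ := Fin.three_add i
        rw [glueApex_face θ hinj]
        refine ⟨⟨i + 1, (hne' i).1, rfl⟩, ?_⟩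
        have := glueApex_inl_inr_left θ (t := t) (i + 2)
        rwa [h21, h22] at this
      · rw [glueApex_inl hi, glueApex_inl, hθ.apex u v h]
        · exact ⟨hθ.adj u v h, rfl⟩
        · rintro ⟨i, rfl, h2⟩
          refine hi ⟨i + 2, ?_, by rw [(Fin.three_add i).2.2.1]⟩
          rw [← (ht i).2, ← h2, hθ.apex u _ h]
    · obtain ⟨j, hj, rfl⟩ := h
      obtain ⟨h11, h12, h21, h22⟩ := Fin.three_add l
      rcases Fin.eq_add_of_ne hj with rfl | rfl
      · rw [glueApex_inl_inr_right θ hinj, glueApex_inr_inr_right]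
        exact ⟨(hne l).2.2.2, rfl⟩
      · rw [glueApex_inl_inr_left, glueApex_inr_inl_left]
        exact ⟨⟨l + 1, (hne l).1, rfl⟩, rfl⟩
    · obtain ⟨j, hj, rfl⟩ := h
      obtain ⟨h11, h12, h21, h22⟩ := Fin.three_add k
      rcases Fin.eq_add_of_ne hj with rfl | rfl
      · rw [glueApex_inr_inl_left, ← h11, glueApex_face θ hinj, h12]
        exact ⟨(ht _).1, rfl⟩
      · rw [glueApex_inr_inl_right θ hinj]
        refine ⟨⟨k + 2, (hne' k).2, rfl⟩, ?_⟩
        have := glueApex_inl_inr_right θ hinj (k + 1)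
        rwa [h11, h12] at this
    · obtain ⟨h11, h12, h21, h22⟩ := Fin.three_add k
      rcases Fin.eq_add_of_ne (Ne.symm h) with rfl | rfl
      · rw [glueApex_inr_inr_left]
        refine ⟨(hne' k).1, ?_⟩
        have := glueApex_inr_inr_left θ (t := t) (k + 1)
        rwa [h11, h12] at this
      · rw [glueApex_inr_inr_right]
        refine ⟨⟨k + 1, (hne' k).1, rfl⟩, ?_⟩
        have := glueApex_inr_inl_right θ hinj (k + 2)
        rwa [h21, h22] at this
  refine ⟨fun x y h => (hboth x y h).1, fun x y h => (hboth x y h).2, ?_⟩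
  rintro (v | k) x y hx hy
  · -- every neighbour is joined, in both directions, to an old neighbour
    have key : ∀ x, (glueOctahedron G t).Adj (.inl v) x →
        (∃ a, G.Adj v a ∧ Relation.ReflTransGen
          (LinkStep (glueApex θ t) (.inl v)) x (.inl a)) ∧
        ∃ a, G.Adj v a ∧ Relation.ReflTransGen
          (LinkStep (glueApex θ t) (.inl v)) (.inl a) x := by
      rintro (a | k) ha
      · exact ⟨⟨a, ha, .refl⟩, ⟨a, ha, .refl⟩⟩
      · obtain ⟨j, hj, rfl⟩ := ha
        obtain ⟨h11, h12, h21, h22⟩ := Fin.three_add k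
        have s1 := glueApex_face θ hinj (k + 1)
        have s2 := glueApex_inr_inl_right θ hinj k
        have s3 := glueApex_inr_inl_left θ (t := t) k
        have s1' := glueApex_face θ hinj k
        have s2' := glueApex_inr_inl_right θ hinj (k + 2)
        have s3' := glueApex_inr_inl_left θ (t := t) (k + 1)
        rw [h11, h12] at s1 s3'
        rw [h21, h22] at s2'
        rcases Fin.eq_add_of_ne hj with rfl | rfl
        · refine ⟨⟨t (k + 2), ?_, linkStep_path s3⟩, ⟨t k, (ht k).1.symm,
            (linkStep_path s1').trans (linkStep_path s2')⟩⟩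
          rw [← h11]
          exact (ht (k + 1)).1
        · refine ⟨⟨t k, ?_, (linkStep_path s2).trans (linkStep_path s3')⟩,
            ⟨t (k + 1), ?_, linkStep_path s1⟩⟩
          · have := (ht (k + 2)).1
            rwa [h21] at this
          · have := (ht (k + 1)).1
            rw [h11] at this
            exact this.symm
    obtain ⟨a, ha, hxa⟩ := (key x hx).1
    obtain ⟨b, hb, hby⟩ := (key y hy).2
    exact (hxa.trans (glueApex_link_inl ht (hθ.link v a b ha hb))).trans hby
  · obtain ⟨h11, h12, h21, h22⟩ := Fin.three_add k
    have s1 := glueApex_inl_inr_left θ (t := t) k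
    have s2 := glueApex_inl_inr_right θ hinj k
    have s3 := glueApex_inr_inr_left θ (t := t) (k + 2)
    have s4 := glueApex_inr_inr_right θ (t := t) (k + 1)
    rw [h21, h22] at s3
    rw [h12, h11] at s4
    -- the rotation at `inr k` is the cycle of the four vertices in these steps
    have r1 := linkStep_path s1
    have r2 := r1.trans (linkStep_path s2)
    have r3 := r2.trans (linkStep_path s3)
    have q3 := linkStep_path s4
    have q2 := (linkStep_path s3).trans q3
    have q1 := (linkStep_path s2).trans q2
    have key : ∀ x, (glueOctahedron G t).Adj (.inr k) x →
        Relation.ReflTransGen (LinkStep (glueApex θ t) (.inr k)) x (.inl (t (k + 2))) ∧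
        Relation.ReflTransGen (LinkStep (glueApex θ t) (.inr k)) (.inl (t (k + 2))) x := by
      rintro (u | l) h
      · obtain ⟨j, hj, rfl⟩ := h
        rcases Fin.eq_add_of_ne hj with rfl | rfl
        · exact ⟨q1, r1⟩
        · exact ⟨.refl, .refl⟩
      · rcases Fin.eq_add_of_ne (Ne.symm h) with rfl | rfl
        · exact ⟨q3, r3⟩
        · exact ⟨q2, r2⟩
    exact (key x hx).1.trans (key y hy).2

theorem isApexFace_glueApex (θ : V → V → V) :
    IsApexFace (glueOctahedron G t) (glueApex θ t) Sum.inr := by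
  intro i
  refine ⟨?_, glueApex_inr_inr_left θ i⟩
  change i ≠ i + 1
  revert i; decide

theorem SimpleGraph.Connected.glueOctahedron (hG : G.Connected) :
    (glueOctahedron G t).Connected := by
  have := hG.nonempty
  rw [SimpleGraph.connected_iff_exists_forall_reachable]
  have hinl (v : V) : (_root_.glueOctahedron G t).Reachable (.inl (t 0)) (.inl v) :=
    (hG.preconnected (t 0) v).map (⟨Sum.inl, fun h => h⟩ : G →g _root_.glueOctahedron G t)
  refine ⟨.inl (t 0), ?_⟩
  rintro (v | k)
  · exact hinl v
  · have : (_root_.glueOctahedron G t).Adj (.inl (t (k + 1))) (.inr k) :=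
      ⟨k + 1, by revert k; decide, rfl⟩
    exact (hinl _).trans this.reachable

theorem ncard_setOf_ne_fin_three (a : Fin 3) : {i | a ≠ i}.ncard = 2 := by
  have : {i | a ≠ i} = {a + 1, a + 2} := by
    ext i
    simp only [Set.mem_ofPred_eq, Set.mem_insert_iff, Set.mem_singleton_iff]
    revert a i; decide
  rw [this, Set.ncard_pair (by clear this; revert a; decide)]

theorem glueOctahedron_neighborSet_inl (u : V) : (glueOctahedron G t).neighborSet (.inl u) =
    Sum.inl '' G.neighborSet u ∪ Sum.inr '' {i | ∃ j, j ≠ i ∧ u = t j} := by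
  ext (v | i)
  · simp [glueOctahedron]
  · simp [glueOctahedron]

theorem ncard_neighborSet_inl [Finite V] (u : V) :
    ((glueOctahedron G t).neighborSet (.inl u)).ncard =
      (G.neighborSet u).ncard + {i | ∃ j, j ≠ i ∧ u = t j}.ncard := by
  rw [glueOctahedron_neighborSet_inl, Set.ncard_union_eq, Set.ncard_image_of_injective _
    Sum.inl_injective, Set.ncard_image_of_injective _ Sum.inr_injective]
  exact Set.disjoint_image_inl_image_inr

theorem ncard_neighborSet_inl_of_notMem [Finite V] {u : V} (hu : u ∉ Set.range t) :
    ((glueOctahedron G t).neighborSet (.inl u)).ncard = (G.neighborSet u).ncard := by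
  rw [ncard_neighborSet_inl]
  have : {i | ∃ j, j ≠ i ∧ u = t j} = ∅ := by
    ext i
    simp only [Set.mem_ofPred_eq, Set.mem_empty_iff_false, iff_false]
    rintro ⟨j, -, rfl⟩
    exact hu ⟨j, rfl⟩
  rw [this, Set.ncard_empty, add_zero]

theorem ncard_neighborSet_inl_of_injective [Finite V] (ht : Function.Injective t) (a : Fin 3) :
    ((glueOctahedron G t).neighborSet (.inl (t a))).ncard = (G.neighborSet (t a)).ncard + 2 := by
  rw [ncard_neighborSet_inl]
  have : {i | ∃ j, j ≠ i ∧ t a = t j} = {i | a ≠ i} := by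
    ext i
    simp [ht.eq_iff]
  rw [this, ncard_setOf_ne_fin_three]

theorem ncard_neighborSet_inr [Finite V] (ht : Function.Injective t) (k : Fin 3) :
    ((glueOctahedron G t).neighborSet (.inr k)).ncard = 4 := by
  have : (glueOctahedron G t).neighborSet (.inr k) =
      Sum.inl '' (t '' {i | k ≠ i}) ∪ Sum.inr '' {i | k ≠ i} := by
    ext (v | i)
    · simp [glueOctahedron, eq_comm]
    · simp [glueOctahedron]
  rw [this, Set.ncard_union_eq Set.disjoint_image_inl_image_inr, Set.ncard_image_of_injective _
    Sum.inl_injective, Set.ncard_image_of_injective _ Sum.inr_injective,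
    Set.ncard_image_of_injective _ ht, ncard_setOf_ne_fin_three]

theorem SimpleGraph.two_mul_natCard_edgeSet {V : Type*} [Fintype V] (G : SimpleGraph V) :
    2 * Nat.card G.edgeSet = ∑ v, (G.neighborSet v).ncard := by
  classical
  rw [← SimpleGraph.natCard_dart, Nat.card_eq_fintype_card, G.dart_card_eq_sum_degrees]
  refine Finset.sum_congr rfl fun v _ => ?_
  rw [← SimpleGraph.card_neighborSet_eq_degree, ← Nat.card_eq_fintype_card]
  rfl

theorem natCard_edgeSet_glueOctahedron [Finite V] (ht : Function.Injective t) :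
    Nat.card (glueOctahedron G t).edgeSet = Nat.card G.edgeSet + 9 := by
  classical
  have := Fintype.ofFinite V
  have h1 := (glueOctahedron G t).two_mul_natCard_edgeSet
  have h2 := G.two_mul_natCard_edgeSet
  have hdeg (u : V) : ((glueOctahedron G t).neighborSet (.inl u)).ncard =
      (G.neighborSet u).ncard + if u ∈ Finset.univ.image t then 2 else 0 := by
    by_cases hu : u ∈ Finset.univ.image t
    · rw [if_pos hu]
      obtain ⟨a, -, rfl⟩ := Finset.mem_image.1 hu
      exact ncard_neighborSet_inl_of_injective ht a
    · rw [if_neg hu]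
      exact ncard_neighborSet_inl_of_notMem (by simpa using hu)
  rw [Fintype.sum_sum_type] at h1
  simp only [hdeg, ncard_neighborSet_inr ht, Finset.sum_add_distrib] at h1
  rw [Finset.sum_ite_mem, Finset.univ_inter, Finset.sum_const,
    Finset.card_image_of_injective _ ht, ← h2] at h1
  simp only [Finset.card_univ, Fintype.card_fin, smul_eq_mul, Finset.sum_const] at h1
  omega

theorem HasTriangularEmbedding.glueOctahedron [Finite V] (h : HasTriangularEmbedding G t) :
    HasTriangularEmbedding (glueOctahedron G t) Sum.inr := by
  obtain ⟨θ, hθ, ht⟩ := h.exists_apexMap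
  refine ⟨h.connected.glueOctahedron, ?_, _, isApexMap_glueApex hθ ht, isApexFace_glueApex θ⟩
  rw [natCard_edgeSet_glueOctahedron ht.injective, Nat.card_sum, Nat.card_fin]
  have := h.card_edgeSet
  omega

end Glue

/-! ### Towers -/

section Tower

variable {V : Type*} {G : SimpleGraph V} {t : Fin 3 → V}

theorem natCard_towerVertex [Finite V] (m : ℕ) :
    Nat.card (TowerVertex V m) = Nat.card V + 3 * m := by
  induction m with
  | zero => rfl
  | succ m ih =>
    change Nat.card (TowerVertex V m ⊕ Fin 3) = _
    rw [Nat.card_sum, ih, Nat.card_fin]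
    ring

theorem HasTriangularEmbedding.octahedronTower [Finite V] (h : HasTriangularEmbedding G t) :
    ∀ m, HasTriangularEmbedding (octahedronTower G t m) (outerTriangle t m)
  | 0 => h
  | m + 1 => (h.octahedronTower m).glueOctahedron

theorem outerTriangle_injective (ht : Function.Injective t) :
    ∀ m, Function.Injective (outerTriangle t m)
  | 0 => ht
  | _ + 1 => Sum.inr_injective

/-- Gluing adds `2` to the degrees of the old triangle, and the new vertices have degree `4`. -/
theorem even_ncard_neighborSet_octahedronTower [Finite V] (ht : Function.Injective t)
    (h : ∀ v, Even (G.neighborSet v).ncard) :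
    ∀ m v, Even ((octahedronTower G t m).neighborSet v).ncard
  | 0 => h
  | m + 1 => by
    rintro (v | k)
    · have ih := even_ncard_neighborSet_octahedronTower ht h m v
      by_cases hv : v ∈ Set.range (outerTriangle t m)
      · obtain ⟨a, rfl⟩ := hv
        have := ncard_neighborSet_inl_of_injective (G := octahedronTower G t m)
          (outerTriangle_injective ht m) a
        exact this ▸ ih.add even_two
      · have := ncard_neighborSet_inl_of_notMem (G := octahedronTower G t m) hv
        exact this ▸ ih
    · have := ncard_neighborSet_inr (G := octahedronTower G t m)
        (outerTriangle_injective ht m) k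
      exact this ▸ by decide

/-- A vertex off the outer triangle keeps its degree forever. -/
theorem exists_odd_ncard_neighborSet_octahedronTower [Finite V]
    (h : ∃ v ∉ Set.range t, Odd (G.neighborSet v).ncard) :
    ∀ m, ∃ v ∉ Set.range (outerTriangle t m), Odd ((octahedronTower G t m).neighborSet v).ncard
  | 0 => h
  | m + 1 => by
    obtain ⟨v, hv, hodd⟩ := exists_odd_ncard_neighborSet_octahedronTower h m
    refine ⟨.inl v, ?_, ?_⟩
    · rintro ⟨i, hi⟩
      exact Sum.inr_ne_inl hi
    · have := ncard_neighborSet_inl_of_notMem (G := octahedronTower G t m) hv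
      exact this ▸ hodd

end Tower

/-! ### Connected dominating sets -/

section ConnectedDomination

variable {V : Type*} {G : SimpleGraph V}

theorem connectedDominationNumber_eq {n : ℕ}
    (h : ∃ S, IsConnectedDominatingSet G S ∧ S.card = n)
    (hle : ∀ S, IsConnectedDominatingSet G S → n ≤ S.card) : connectedDominationNumber G = n := by
  refine le_antisymm (Nat.sInf_le h) (le_csInf ⟨n, h⟩ ?_)
  rintro _ ⟨S, hS, rfl⟩
  exact hle S hS

theorem IsConnectedDominatingSet.connected {S : Finset V} (hS : IsConnectedDominatingSet G S) :
    G.Connected := by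
  obtain ⟨c, hc⟩ := SimpleGraph.connected_iff_exists_forall_reachable _ |>.1 hS.2
  have key (u : V) (hu : u ∈ S) : G.Reachable c u :=
    (hc ⟨u, hu⟩).map (SimpleGraph.Embedding.induce (S : Set V)).toHom
  refine (SimpleGraph.connected_iff_exists_forall_reachable _).2 ⟨c, fun v => ?_⟩
  rcases hS.1 v with hv | ⟨u, hu, huv⟩
  · exact key v hv
  · exact (key u hu).trans huv.reachable

theorem connected_induce_of_star {S : Set V} {c : V} (hc : c ∈ S)
    (h : ∀ v ∈ S, v = c ∨ G.Adj c v) : (G.induce S).Connected := by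
  refine (SimpleGraph.connected_iff_exists_forall_reachable _).2 ⟨⟨c, hc⟩, fun ⟨v, hv⟩ => ?_⟩
  rcases h v hv with rfl | h
  · exact SimpleGraph.Reachable.refl _
  · exact SimpleGraph.Adj.reachable (G := G.induce S) h

theorem exists_adj_of_connected_induce {S : Set V} (hS : (G.induce S).Connected) {u v : V}
    (hu : u ∈ S) (hv : v ∈ S) (huv : u ≠ v) : ∃ w ∈ S, G.Adj u w := by
  have : Nontrivial S := ⟨⟨u, hu⟩, ⟨v, hv⟩, fun h => huv (congrArg Subtype.val h)⟩
  obtain ⟨⟨w, hw⟩, h⟩ := hS.preconnected.exists_adj_of_nontrivial ⟨u, hu⟩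
  exact ⟨w, hw, h⟩

theorem exists_boundary_adj_of_connected_induce {S A : Set V} (hS : (G.induce S).Connected)
    {u v : V} (hu : u ∈ S) (hv : v ∈ S) (huA : u ∈ A) (hvA : v ∉ A) :
    ∃ a ∈ S, ∃ b ∈ S, G.Adj a b ∧ a ∈ A ∧ b ∉ A := by
  obtain ⟨p⟩ := hS.preconnected ⟨u, hu⟩ ⟨v, hv⟩
  obtain ⟨d, -, h1, h2⟩ := p.exists_boundary_dart (Subtype.val ⁻¹' A) huA hvA
  exact ⟨d.fst, d.fst.2, d.snd, d.snd.2, d.adj, h1, h2⟩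

/-- Discrete intermediate value theorem. -/
theorem exists_eq_of_connected_induce {S : Set V} (hS : (G.induce S).Connected) {f : V → ℕ}
    (hf : ∀ u v, G.Adj u v → f v ≤ f u + 1) {u v : V} (hu : u ∈ S) (hv : v ∈ S) {j : ℕ}
    (h1 : f u ≤ j) (h2 : j ≤ f v) : ∃ w ∈ S, f w = j := by
  rcases h1.eq_or_lt with h1 | h1
  · exact ⟨u, hu, h1⟩
  obtain ⟨a, -, b, hb, hab, ha, hbj⟩ := exists_boundary_adj_of_connected_induce (A := {w | f w < j})
    hS hu hv h1 (by simpa using h2)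
  have := hf a b hab
  have ha' : f a < j := ha
  have hbj' : ¬ f b < j := hbj
  exact ⟨b, hb, by omega⟩

theorem IsConnectedDominatingSet.exists_pair_of_card_le_two {S : Finset V}
    (hS : IsConnectedDominatingSet G S) (h : S.card ≤ 2) :
    ∃ a b, (a = b ∨ G.Adj a b) ∧ ∀ v, v = a ∨ v = b ∨ G.Adj a v ∨ G.Adj b v := by
  classical
  obtain ⟨⟨a, ha⟩⟩ := hS.2.nonempty
  have ha : a ∈ S := ha
  have hcard : (S.erase a).card ≤ 1 := by
    rw [Finset.card_erase_of_mem ha]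
    omega
  by_cases he : ∃ b ∈ S, b ≠ a
  · obtain ⟨b, hb, hba⟩ := he
    have hall : ∀ x ∈ S, x = a ∨ x = b := by
      intro x hx
      by_contra! hne
      exact hne.2 (Finset.card_le_one.1 hcard x (by simp [hx, hne.1]) b (by simp [hb, hba]))
    refine ⟨a, b, Or.inr ?_, fun v => ?_⟩
    · obtain ⟨w, hw, haw⟩ := exists_adj_of_connected_induce hS.2 ha hb hba.symm
      rcases hall w hw with rfl | rfl
      · exact absurd haw (G.irrefl)
      · exact haw
    · rcases hS.1 v with hv | ⟨u, hu, huv⟩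
      · rcases hall v hv with h | h <;> simp [h]
      · rcases hall u hu with rfl | rfl <;> simp [huv]
  · push Not at he
    refine ⟨a, a, Or.inl rfl, fun v => ?_⟩
    rcases hS.1 v with hv | ⟨u, hu, huv⟩
    · exact Or.inl (he v hv)
    · rw [he u hu] at huv
      simp [huv]

end ConnectedDomination

/-! ### Connected dominating sets of towers -/

section TowerDomination

variable {V : Type*} {G : SimpleGraph V} {t : Fin 3 → V}

theorem isConnectedDominatingSet_glueOctahedron {S : Finset V}
    (hS : IsConnectedDominatingSet G S) {i : Fin 3} (hi : t i ∈ S) :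
    IsConnectedDominatingSet (glueOctahedron G t) (S.disjSum {i + 1}) := by
  have hi1 : i ≠ i + 1 := by clear hi; revert i; decide
  have hadj : (glueOctahedron G t).Adj (.inl (t i)) (.inr (i + 1)) := ⟨i, hi1, rfl⟩
  refine ⟨?_, ?_⟩
  · rintro (v | k)
    · rcases hS.1 v with hv | ⟨u, hu, huv⟩
      · exact Or.inl (Finset.inl_mem_disjSum.2 hv)
      · exact Or.inr ⟨.inl u, Finset.inl_mem_disjSum.2 hu, huv⟩
    · have hmem : (Sum.inr (i + 1) : V ⊕ Fin 3) ∈ S.disjSum {i + 1} :=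
        Finset.inr_mem_disjSum.2 (Finset.mem_singleton_self _)
      by_cases hk : i + 1 = k
      · exact Or.inl (hk ▸ hmem)
      · exact Or.inr ⟨_, hmem, hk⟩
  · refine (SimpleGraph.connected_iff_exists_forall_reachable _).2
      ⟨⟨.inl (t i), Finset.inl_mem_disjSum.2 hi⟩, ?_⟩
    rintro ⟨v | k, hv⟩
    · let φ : G.induce (S : Set V) →g
          (glueOctahedron G t).induce (S.disjSum {i + 1} : Finset (V ⊕ Fin 3)) :=
        ⟨fun x => ⟨.inl x, Finset.inl_mem_disjSum.2 x.2⟩, fun h => h⟩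
      exact (hS.2.preconnected ⟨t i, hi⟩ ⟨v, Finset.inl_mem_disjSum.1 hv⟩).map φ
    · obtain rfl := Finset.mem_singleton.1 (Finset.inr_mem_disjSum.1 hv)
      exact SimpleGraph.Adj.reachable (G := (glueOctahedron G t).induce _) hadj

theorem exists_isConnectedDominatingSet_octahedronTower {n : ℕ}
    (h : ∃ S, IsConnectedDominatingSet G S ∧ S.card = n ∧ ∃ i, t i ∈ S) :
    ∀ m, ∃ S, IsConnectedDominatingSet (octahedronTower G t m) S ∧ S.card = m + n ∧
      ∃ i, outerTriangle t m i ∈ S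
  | 0 => by
    rw [Nat.zero_add]
    exact h
  | m + 1 => by
    obtain ⟨S, hS, hcard, i, hi⟩ := exists_isConnectedDominatingSet_octahedronTower h m
    refine ⟨S.disjSum {i + 1}, isConnectedDominatingSet_glueOctahedron hS hi, ?_, i + 1,
      Finset.inr_mem_disjSum.2 (Finset.mem_singleton_self _)⟩
    refine (Finset.card_disjSum _ _).trans ?_
    rw [hcard, Finset.card_singleton]
    omega

/-- The gluing step in which a vertex of a tower was put in; it is `0` on the starting graph. -/
def towerLevel : (m : ℕ) → TowerVertex V m → ℕ
  | 0, _ => 0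
  | m + 1, .inl v => towerLevel m v
  | m + 1, .inr _ => m + 1

/-- The inclusion of the starting graph into a tower. -/
def towerBase : (m : ℕ) → V → TowerVertex V m
  | 0, v => v
  | m + 1, v => .inl (towerBase m v)

theorem towerLevel_le : ∀ (m : ℕ) (x : TowerVertex V m), towerLevel m x ≤ m
  | 0, _ => le_rfl
  | m + 1, .inl x => (towerLevel_le m x).trans m.le_succ
  | _ + 1, .inr _ => le_rfl

theorem towerLevel_outerTriangle (t : Fin 3 → V) (i : Fin 3) :
    ∀ m, towerLevel m (outerTriangle t m i) = m
  | 0 => rfl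
  | _ + 1 => rfl

theorem towerLevel_towerBase (v : V) : ∀ m, towerLevel m (towerBase m v) = 0
  | 0 => rfl
  | m + 1 => towerLevel_towerBase v m

theorem exists_towerBase_eq : ∀ (m : ℕ) (x : TowerVertex V m), towerLevel m x = 0 →
    ∃ v, towerBase m v = x
  | 0, x, _ => ⟨x, rfl⟩
  | m + 1, .inl x, h => (exists_towerBase_eq m x h).imp fun _ hv => congrArg Sum.inl hv

theorem towerBase_injective : ∀ m, Function.Injective (towerBase (V := V) m)
  | 0 => fun _ _ h => h
  | m + 1 => fun _ _ h => towerBase_injective m (Sum.inl_injective h)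

theorem octahedronTower_adj_towerBase (u v : V) : ∀ m,
    (octahedronTower G t m).Adj (towerBase m u) (towerBase m v) ↔ G.Adj u v
  | 0 => Iff.rfl
  | m + 1 => octahedronTower_adj_towerBase u v m

theorem towerLevel_le_of_adj : ∀ (m : ℕ) (x y : TowerVertex V m),
    (octahedronTower G t m).Adj x y → towerLevel m y ≤ towerLevel m x + 1
  | 0, _, _, _ => Nat.zero_le _
  | m + 1, .inl x, .inl y, h => towerLevel_le_of_adj m x y h
  | m + 1, .inl x, .inr i, h => by
    obtain ⟨j, -, rfl⟩ := h
    exact Nat.succ_le_succ (towerLevel_outerTriangle t j m).ge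
  | m + 1, .inr i, y, _ => (towerLevel_le (m + 1) y).trans (Nat.le_succ _)

/-- Only the vertices of the starting triangle have neighbours outside the starting graph. -/
theorem mem_range_of_adj_towerBase (v : V) : ∀ (m : ℕ) (y : TowerVertex V m),
    (octahedronTower G t m).Adj (towerBase m v) y → towerLevel m y ≠ 0 → v ∈ Set.range t
  | 0, _, _, h => absurd rfl h
  | m + 1, .inl y, h, hy => mem_range_of_adj_towerBase v m y h hy
  | m + 1, .inr i, h, _ => by
    obtain ⟨j, -, hj⟩ := h
    have hm : m = 0 := by
      rw [← towerLevel_outerTriangle t j m, ← hj, towerLevel_towerBase]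
    subst hm
    exact ⟨j, hj.symm⟩

theorem exists_base_dominator {m : ℕ} {S : Finset (TowerVertex V m)}
    (hS : IsDominatingSet (octahedronTower G t m) S) {v : V} (hv : v ∉ Set.range t) :
    ∃ u, towerBase m u ∈ S ∧ (u = v ∨ G.Adj u v) := by
  rcases hS (towerBase m v) with h | ⟨x, hx, hxv⟩
  · exact ⟨v, h, Or.inl rfl⟩
  · have h0 : towerLevel m x = 0 := by
      by_contra h0
      exact hv (mem_range_of_adj_towerBase v m x hxv.symm h0)
    obtain ⟨u, rfl⟩ := exists_towerBase_eq m x h0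
    exact ⟨u, hx, Or.inr ((octahedronTower_adj_towerBase u v m).1 hxv)⟩

/-- The last triangle is dominated by one of its vertices or by two vertices of the triangle
before it. -/
theorem last_levels {m : ℕ} {S : Finset (TowerVertex V (m + 1))}
    (hS : IsDominatingSet (octahedronTower G t (m + 1)) S) (ht : Function.Injective t) :
    1 ≤ (S.filter fun x => towerLevel (m + 1) x = m + 1).card ∨
      2 ≤ (S.filter fun x => towerLevel (m + 1) x = m).card := by
  by_cases h : ∃ i : Fin 3, (Sum.inr i : TowerVertex V m ⊕ Fin 3) ∈ S
  · obtain ⟨i, hi⟩ := h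
    exact Or.inl (Finset.card_pos.2 ⟨_, Finset.mem_filter.2 ⟨hi, rfl⟩⟩)
  · right
    have key (k : Fin 3) : ∃ j, j ≠ k ∧
        (Sum.inl (outerTriangle t m j) : TowerVertex V m ⊕ Fin 3) ∈ S := by
      rcases hS (Sum.inr k : TowerVertex V m ⊕ Fin 3) with hk | ⟨u | l, hu, huk⟩
      · exact absurd ⟨k, hk⟩ h
      · obtain ⟨j, hj, rfl⟩ := huk
        exact ⟨j, hj, hu⟩
      · exact absurd ⟨l, hu⟩ h
    obtain ⟨i, -, hi⟩ := key 0
    obtain ⟨j, hji, hj⟩ := key i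
    refine Finset.one_lt_card.2 ⟨_, Finset.mem_filter.2 ⟨hi, towerLevel_outerTriangle t i m⟩,
      _, Finset.mem_filter.2 ⟨hj, towerLevel_outerTriangle t j m⟩, fun he => hji ?_⟩
    exact (outerTriangle_injective ht m (Sum.inl_injective he)).symm

/-- A vertex `a` of the triangle `t` together with a second vertex that is a neighbour of `a` or
lies on `t` never dominates all vertices outside of `t`. -/
def NoDominatingPair (G : SimpleGraph V) (t : Fin 3 → V) : Prop :=
  ∀ a b, a ∈ Set.range t → (b ∈ Set.range t ∨ G.Adj a b) →
    ∃ v ∉ Set.range t, v ≠ a ∧ v ≠ b ∧ ¬ G.Adj a v ∧ ¬ G.Adj b v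

/-- The starting graph holds at least three vertices of a connected dominating set that leaves
it. -/
theorem three_le_card_level_zero (hG : NoDominatingPair G t) {m : ℕ}
    {S : Finset (TowerVertex V m)}
    (hS : IsConnectedDominatingSet (octahedronTower G t m) S)
    (hne : ∃ x ∈ S, towerLevel m x ≠ 0) :
    3 ≤ (S.filter fun x => towerLevel m x = 0).card := by
  classical
  obtain ⟨y, hy, hy0⟩ := hne
  obtain ⟨v, hv, -⟩ := hG (t 0) (t 0) ⟨0, rfl⟩ (Or.inl ⟨0, rfl⟩)
  obtain ⟨u, hu, -⟩ := exists_base_dominator hS.1 hv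
  -- connectivity forces `S` to use a vertex of the starting triangle
  obtain ⟨a', ha', z, hz, haz, ha0, hz0⟩ :=
    exists_boundary_adj_of_connected_induce (A := {x | towerLevel m x = 0}) hS.2 hu hy
      (towerLevel_towerBase u m) hy0
  obtain ⟨a, rfl⟩ := exists_towerBase_eq m a' ha0
  have hat := mem_range_of_adj_towerBase a m z haz hz0
  have ha : towerBase m a ∈ S := ha'
  by_contra! hlt
  have hcard : ((S.filter fun x => towerLevel m x = 0).erase (towerBase m a)).card ≤ 1 := by
    rw [Finset.card_erase_of_mem (by simp [ha, towerLevel_towerBase])]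
    omega
  obtain ⟨b, hb, hall⟩ : ∃ b, (b ∈ Set.range t ∨ G.Adj a b) ∧
      ∀ w, towerBase m w ∈ S → w = a ∨ w = b := by
    by_cases he : ∃ b, towerBase m b ∈ S ∧ towerBase m b ≠ towerBase m a
    · obtain ⟨b, hbS, hba⟩ := he
      have hall' : ∀ w, towerBase m w ∈ S → towerBase m w = towerBase m a ∨
          towerBase m w = towerBase m b := by
        intro w hw
        by_contra! hne
        refine hne.2 (Finset.card_le_one.1 hcard _ ?_ _ ?_)
        · simp [hw, hne.1, towerLevel_towerBase]
        · simp [hbS, hba, towerLevel_towerBase]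
      refine ⟨b, ?_, fun w hw => (hall' w hw).imp (fun h => ?_) (fun h => ?_)⟩
      · obtain ⟨w, hw, hbw⟩ := exists_adj_of_connected_induce hS.2 hbS ha hba
        by_cases hw0 : towerLevel m w = 0
        · obtain ⟨w, rfl⟩ := exists_towerBase_eq m w hw0
          rcases hall' w hw with h | h
          · rw [h, octahedronTower_adj_towerBase] at hbw
            exact Or.inr hbw.symm
          · rw [h] at hbw
            exact absurd hbw (SimpleGraph.irrefl _)
        · exact Or.inl (mem_range_of_adj_towerBase b m w hbw hw0)
      · exact towerBase_injective m h
      · exact towerBase_injective m h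
    · push Not at he
      exact ⟨a, Or.inl hat, fun w hw => Or.inl (towerBase_injective m (he w hw))⟩
  obtain ⟨v, hvt, hva, hvb, hav, hbv⟩ := hG a b hat hb
  obtain ⟨u, hu, huv⟩ := exists_base_dominator hS.1 hvt
  rcases hall u hu with rfl | rfl
  · exact huv.elim (fun h => hva h.symm) hav
  · exact huv.elim (fun h => hvb h.symm) hbv

/-- There are three vertices on level `0`, and the levels from `1` to `m` hold `m` vertices: by
connectivity none of them is missed except possibly the last, in which case the one before it
has two. For `m ≥ 2` that one is not level `0`. -/
theorem card_ge_of_isConnectedDominatingSet (hG : NoDominatingPair G t)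
    (ht : Function.Injective t) (n : ℕ) {S : Finset (TowerVertex V (n + 2))}
    (hS : IsConnectedDominatingSet (octahedronTower G t (n + 2)) S) : n + 5 ≤ S.card := by
  have hlast : 1 ≤ (S.filter fun x => towerLevel (n + 2) x = n + 2).card ∨
      2 ≤ (S.filter fun x => towerLevel (n + 2) x = n + 1).card := last_levels hS.1 ht
  obtain ⟨y, hy, hyl⟩ : ∃ y ∈ S, n + 1 ≤ towerLevel (n + 2) y := by
    rcases hlast with h | h
    · obtain ⟨y, hy⟩ := Finset.card_pos.1 h
      rw [Finset.mem_filter] at hy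
      exact ⟨y, hy.1, by omega⟩
    · obtain ⟨y, hy⟩ := Finset.card_pos.1 (zero_lt_two.trans_le h)
      rw [Finset.mem_filter] at hy
      exact ⟨y, hy.1, by omega⟩
  have hbase := three_le_card_level_zero hG hS ⟨y, hy, by omega⟩
  obtain ⟨x, hx⟩ := Finset.card_pos.1 (zero_lt_three.trans_le hbase)
  rw [Finset.mem_filter] at hx
  have hmid (j : ℕ) (hj : j ≤ n + 1) :
      1 ≤ (S.filter fun x => towerLevel (n + 2) x = j).card := by
    obtain ⟨w, hw, hwj⟩ := exists_eq_of_connected_induce hS.2 (towerLevel_le_of_adj (n + 2))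
      hx.1 hy (j := j) (by omega) (by omega)
    exact Finset.card_pos.2 ⟨w, Finset.mem_filter.2 ⟨hw, hwj⟩⟩
  have hsum := Finset.card_eq_sum_card_fiberwise (s := S) (t := Finset.range (n + 3))
    (f := towerLevel (n + 2)) fun x _ =>
      Finset.mem_coe.2 (Finset.mem_range.2 (Nat.lt_succ_of_le (towerLevel_le (n + 2) x)))
  rw [Finset.sum_range_succ, Finset.sum_range_succ, Finset.sum_range_succ'] at hsum
  have hinner : n ≤ ∑ j ∈ Finset.range n,
      (S.filter fun x => towerLevel (n + 2) x = j + 1).card := by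
    have := Finset.card_nsmul_le_sum (Finset.range n)
      (fun j => (S.filter fun x => towerLevel (n + 2) x = j + 1).card) 1 fun j hj =>
        hmid (j + 1) (by have := Finset.mem_range.1 hj; omega)
    simpa using this
  have h1 := hmid (n + 1) le_rfl
  rcases hlast with h | h <;> omega

/-- From the second gluing step on, the connected domination number of the tower is a third of its
number of vertices. -/
theorem connectedDominationNumber_octahedronTower (hG : NoDominatingPair G t)
    (ht : Function.Injective t)
    (h : ∃ S, IsConnectedDominatingSet G S ∧ S.card = 3 ∧ ∃ i, t i ∈ S) {m : ℕ} (hm : 2 ≤ m) :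
    connectedDominationNumber (octahedronTower G t m) = m + 3 := by
  obtain ⟨n, rfl⟩ := Nat.exists_eq_add_of_le' hm
  refine connectedDominationNumber_eq ?_ fun S hS => card_ge_of_isConnectedDominatingSet hG ht n hS
  obtain ⟨S, hS, hcard, -⟩ := exists_isConnectedDominatingSet_octahedronTower h (n + 2)
  exact ⟨S, hS, hcard⟩

end TowerDomination

/-! ### The two starting graphs -/

/-- The apex map of an embedding whose faces are given by a list of oriented triangles. -/
def faceListApex {V : Type*} [DecidableEq V] (L : List (V × V × V)) (u v : V) : V :=
  ((L.flatMap fun f => [f, (f.2.1, f.2.2, f.1), (f.2.2, f.1, f.2.1)]).find?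
    fun f => f.1 = u && f.2.1 = v).elim u fun f => f.2.2

instance : DecidableRel nestedTriangles.Adj := fun _ _ =>
  decidable_of_iff _ (SimpleGraph.fromRel_adj _ _ _).symm

instance : DecidableRel cappedPrism.Adj := fun _ _ =>
  decidable_of_iff _ (SimpleGraph.fromRel_adj _ _ _).symm

/-- The bound `N` makes the hypothesis decidable. -/
theorem linkStep_path_of_iterate {V : Type*} {θ : V → V → V} {v w w' : V} {N : ℕ}
    (h : ∃ n < N, (fun a => θ a v)^[n] w = w') :
    Relation.ReflTransGen (LinkStep θ v) w w' := by
  obtain ⟨n, -, rfl⟩ := h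
  induction n with
  | zero => exact .refl
  | succ n ih =>
    rw [Function.iterate_succ_apply']
    exact ih.tail rfl

theorem SimpleGraph.ncard_neighborSet {V : Type*} (G : SimpleGraph V) (v : V)
    [Fintype (G.neighborSet v)] : (G.neighborSet v).ncard = G.degree v := by
  rw [← G.card_neighborSet_eq_degree, ← Nat.card_eq_fintype_card]
  rfl

theorem isConnectedDominatingSet_of_star {V : Type*} {G : SimpleGraph V} {S : Finset V} {c : V}
    (hd : IsDominatingSet G S) (hc : c ∈ S) (h : ∀ v ∈ S, v = c ∨ G.Adj c v) :
    IsConnectedDominatingSet G S :=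
  ⟨hd, connected_induce_of_star hc h⟩

/-- The faces of an embedding of `nestedTriangles`: the first and the last triangle, and between
them two bands of six triangles. -/
def nestedTrianglesFaces : List (Fin 9 × Fin 9 × Fin 9) :=
  [(1, 0, 2), (0, 1, 5), (1, 2, 3), (2, 0, 4), (0, 5, 4), (1, 3, 5), (2, 4, 3),
    (3, 4, 8), (4, 5, 6), (5, 3, 7), (3, 8, 7), (4, 6, 8), (5, 7, 6), (6, 7, 8)]

/-- The faces of an embedding of `cappedPrism`: the two triangles of the prism and four triangles
around each cap. -/
def cappedPrismFaces : List (Fin 9 × Fin 9 × Fin 9) :=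
  [(1, 0, 2), (0, 1, 6), (1, 4, 6), (4, 3, 6), (3, 0, 6), (1, 2, 7), (2, 5, 7),
    (5, 4, 7), (4, 1, 7), (2, 0, 8), (0, 3, 8), (3, 5, 8), (5, 2, 8), (3, 4, 5)]

theorem isConnectedDominatingSet_nestedTriangles :
    IsConnectedDominatingSet nestedTriangles {3, 4} :=
  isConnectedDominatingSet_of_star (c := 3) (by unfold IsDominatingSet; decide) (by decide)
    (by decide)

/-- Unlike a smallest connected dominating set, this one contains a vertex of the outer triangle,
so it extends along the tower. -/
theorem isConnectedDominatingSet_nestedTriangles' :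
    IsConnectedDominatingSet nestedTriangles {0, 4, 6} :=
  isConnectedDominatingSet_of_star (c := 4) (by unfold IsDominatingSet; decide) (by decide)
    (by decide)

theorem isConnectedDominatingSet_cappedPrism :
    IsConnectedDominatingSet cappedPrism {0, 1, 2} :=
  isConnectedDominatingSet_of_star (c := 0) (by unfold IsDominatingSet; decide) (by decide)
    (by decide)

theorem isConnectedDominatingSet_cappedPrism' :
    IsConnectedDominatingSet cappedPrism {3, 4, 5} :=
  isConnectedDominatingSet_of_star (c := 3) (by unfold IsDominatingSet; decide) (by decide)
    (by decide)

theorem natCard_edgeSet_nestedTriangles : Nat.card nestedTriangles.edgeSet = 21 := by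
  have := nestedTriangles.two_mul_natCard_edgeSet
  simp only [SimpleGraph.ncard_neighborSet] at this
  have h : ∑ v, nestedTriangles.degree v = 42 := by decide
  omega

theorem natCard_edgeSet_cappedPrism : Nat.card cappedPrism.edgeSet = 21 := by
  have := cappedPrism.two_mul_natCard_edgeSet
  simp only [SimpleGraph.ncard_neighborSet] at this
  have h : ∑ v, cappedPrism.degree v = 42 := by decide
  omega

theorem hasTriangularEmbedding_nestedTriangles :
    HasTriangularEmbedding nestedTriangles ![6, 7, 8] := by
  refine ⟨isConnectedDominatingSet_nestedTriangles.connected, ?_,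
    faceListApex nestedTrianglesFaces, ⟨by decide +kernel, by decide +kernel, ?_⟩, ?_⟩
  · rw [natCard_edgeSet_nestedTriangles, Nat.card_fin]
  · have h : ∀ v w w', nestedTriangles.Adj v w → nestedTriangles.Adj v w' →
        ∃ n < 6, (fun a => faceListApex nestedTrianglesFaces a v)^[n] w = w' := by
      decide +kernel
    exact fun v w w' hw hw' => linkStep_path_of_iterate (h v w w' hw hw')
  · unfold IsApexFace
    decide +kernel

theorem hasTriangularEmbedding_cappedPrism :
    HasTriangularEmbedding cappedPrism ![3, 4, 5] := by
  refine ⟨isConnectedDominatingSet_cappedPrism.connected, ?_,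
    faceListApex cappedPrismFaces, ⟨by decide +kernel, by decide +kernel, ?_⟩, ?_⟩
  · rw [natCard_edgeSet_cappedPrism, Nat.card_fin]
  · have h : ∀ v w w', cappedPrism.Adj v w → cappedPrism.Adj v w' →
        ∃ n < 5, (fun a => faceListApex cappedPrismFaces a v)^[n] w = w' := by
      decide +kernel
    exact fun v w w' hw hw' => linkStep_path_of_iterate (h v w w' hw hw')
  · unfold IsApexFace
    decide +kernel

theorem connectedDominationNumber_nestedTriangles :
    connectedDominationNumber nestedTriangles = 2 := by
  refine connectedDominationNumber_eq ⟨_, isConnectedDominatingSet_nestedTriangles, rfl⟩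
    fun S hS => ?_
  by_contra! hlt
  obtain ⟨⟨a, ha⟩⟩ := hS.2.nonempty
  have hno : ∀ a, ∃ v, v ≠ a ∧ ¬ nestedTriangles.Adj a v := by decide
  obtain ⟨v, hva, hav⟩ := hno a
  have hall : ∀ x ∈ S, x = a := fun x hx => Finset.card_le_one.1 (by omega) x hx a ha
  rcases hS.1 v with hv | ⟨u, hu, huv⟩
  · exact hva (hall v hv)
  · exact hav (hall u hu ▸ huv)

theorem connectedDominationNumber_cappedPrism :
    connectedDominationNumber cappedPrism = 3 := by
  refine connectedDominationNumber_eq ⟨_, isConnectedDominatingSet_cappedPrism, rfl⟩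
    fun S hS => ?_
  by_contra! hlt
  obtain ⟨a, b, hab, hv⟩ := hS.exists_pair_of_card_le_two (by omega)
  revert a b
  decide +kernel

theorem noDominatingPair_nestedTriangles : NoDominatingPair nestedTriangles ![6, 7, 8] := by
  have h : ∀ i b, (b ∈ Finset.univ.image ![6, 7, 8] ∨ nestedTriangles.Adj (![6, 7, 8] i) b) →
      ∃ v ∉ Finset.univ.image ![6, 7, 8], v ≠ ![6, 7, 8] i ∧ v ≠ b ∧
        ¬ nestedTriangles.Adj (![6, 7, 8] i) v ∧ ¬ nestedTriangles.Adj b v := by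
    decide +kernel
  have hr (v : Fin 9) : v ∈ Finset.univ.image ![6, 7, 8] ↔ v ∈ Set.range ![6, 7, 8] := by
    simp only [Finset.mem_image, Finset.mem_univ, true_and, Set.mem_range]
  simp only [hr] at h
  rintro _ b ⟨i, rfl⟩ hb
  exact h i b hb

/-- The hypothesis on `t` holds for every triangle of the graph, so the outer face is arbitrary. -/
theorem noDominatingPair_cappedPrism {t : Fin 3 → Fin 9}
    (ht : ∀ i, cappedPrism.Adj (t i) (t (i + 1))) : NoDominatingPair cappedPrism t := by
  have h : ∀ a x, cappedPrism.Adj a x → ∀ y, cappedPrism.Adj x y → cappedPrism.Adj y a → ∀ b,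
      (b = a ∨ b = x ∨ b = y ∨ cappedPrism.Adj a b) →
      ∃ v, (v ≠ a ∧ v ≠ x ∧ v ≠ y) ∧ v ≠ b ∧ ¬ cappedPrism.Adj a v ∧ ¬ cappedPrism.Adj b v := by
    decide +kernel
  have hr (i : Fin 3) (v : Fin 9) : v ∈ Set.range t ↔ v = t i ∨ v = t (i + 1) ∨ v = t (i + 2) := by
    constructor
    · rintro ⟨j, rfl⟩
      have hj : j = i ∨ j = i + 1 ∨ j = i + 2 := by revert i j; decide
      rcases hj with rfl | rfl | rfl <;> simp
    · rintro (rfl | rfl | rfl) <;> exact ⟨_, rfl⟩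
  rintro _ b ⟨i, rfl⟩ hb
  obtain ⟨h11, -, h21, -⟩ := Fin.three_add i
  have e1 := ht (i + 1)
  have e2 := ht (i + 2)
  rw [h11] at e1
  rw [h21] at e2
  rw [hr i] at hb
  obtain ⟨v, ⟨h1, h2, h3⟩, h4, h5, h6⟩ := h _ _ (ht i) _ e1 e2 b (by tauto)
  exact ⟨v, by rw [hr i]; tauto, h1, h4, h5, h6⟩

/-- The two triangles of the prism both work, and every edge has an end on one of them. -/
theorem exists_isConnectedDominatingSet_cappedPrism {t : Fin 3 → Fin 9}
    (ht : cappedPrism.Adj (t 0) (t 1)) :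
    ∃ S, IsConnectedDominatingSet cappedPrism S ∧ S.card = 3 ∧ ∃ i, t i ∈ S := by
  have h : ∀ u v, cappedPrism.Adj u v →
      (u ∈ ({0, 1, 2} : Finset (Fin 9)) ∨ v ∈ ({0, 1, 2} : Finset (Fin 9))) ∨
      (u ∈ ({3, 4, 5} : Finset (Fin 9)) ∨ v ∈ ({3, 4, 5} : Finset (Fin 9))) := by
    decide +kernel
  rcases h _ _ ht with h | h
  · exact ⟨_, isConnectedDominatingSet_cappedPrism, rfl, h.elim (⟨0, ·⟩) (⟨1, ·⟩)⟩
  · exact ⟨_, isConnectedDominatingSet_cappedPrism', rfl, h.elim (⟨0, ·⟩) (⟨1, ·⟩)⟩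

theorem even_ncard_neighborSet_nestedTriangles (v : Fin 9) :
    Even (nestedTriangles.neighborSet v).ncard := by
  rw [SimpleGraph.ncard_neighborSet]
  revert v
  decide

/-- The six vertices of the prism have degree five, and a triangle contains at most three of
them. -/
theorem exists_odd_ncard_neighborSet_cappedPrism (t : Fin 3 → Fin 9) :
    ∃ v ∉ Set.range t, Odd (cappedPrism.neighborSet v).ncard := by
  have hdeg : ∀ v : Fin 9, v < 6 → Odd (cappedPrism.degree v) := by decide
  have hex : ∀ a b c : Fin 9, ∃ v < 6, v ≠ a ∧ v ≠ b ∧ v ≠ c := by decide +kernel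
  obtain ⟨v, hv, h0, h1, h2⟩ := hex (t 0) (t 1) (t 2)
  refine ⟨v, ?_, ?_⟩
  · rintro ⟨i, rfl⟩
    fin_cases i
    · exact h0 rfl
    · exact h1 rfl
    · exact h2 rfl
  · rw [SimpleGraph.ncard_neighborSet]
    exact hdeg v hv

theorem SimpleGraph.Iso.ncard_neighborSet {V W : Type*} {G : SimpleGraph V} {H : SimpleGraph W}
    (e : G ≃g H) (v : V) : (H.neighborSet (e v)).ncard = (G.neighborSet v).ncard :=
  (Nat.card_congr (e.mapNeighborSet v)).symm

theorem proposition4p3 :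
    -- the first family
    (IsTriangulation nestedTriangles ∧ connectedDominationNumber nestedTriangles = 2 ∧
      IsFacialTriangle nestedTriangles ![6, 7, 8] ∧
      ∀ k : ℕ, 5 ≤ k →
        Nat.card (TowerVertex (Fin 9) (k - 3)) = 3 * k ∧
        IsTriangulation (octahedronTower nestedTriangles ![6, 7, 8] (k - 3)) ∧
        connectedDominationNumber (octahedronTower nestedTriangles ![6, 7, 8] (k - 3)) = k) ∧
    -- the second family, for every choice of the outer face of the starting graph
    (IsTriangulation cappedPrism ∧ connectedDominationNumber cappedPrism = 3 ∧
      (∃ t : Fin 3 → Fin 9, IsFacialTriangle cappedPrism t) ∧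
      ∀ t : Fin 3 → Fin 9, IsFacialTriangle cappedPrism t → ∀ k : ℕ, 5 ≤ k →
        Nat.card (TowerVertex (Fin 9) (k - 3)) = 3 * k ∧
        IsTriangulation (octahedronTower cappedPrism t (k - 3)) ∧
        connectedDominationNumber (octahedronTower cappedPrism t (k - 3)) = k) ∧
    -- the two families consist of different graphs
    (∀ t : Fin 3 → Fin 9, IsFacialTriangle cappedPrism t → ∀ k : ℕ, 5 ≤ k →
      IsEmpty (octahedronTower nestedTriangles ![6, 7, 8] (k - 3) ≃g
        octahedronTower cappedPrism t (k - 3))) := by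
  have hA := hasTriangularEmbedding_nestedTriangles
  have hP {t : Fin 3 → Fin 9} (ht : IsFacialTriangle cappedPrism t) :
      HasTriangularEmbedding cappedPrism t :=
    ht.hasTriangularEmbedding hasTriangularEmbedding_cappedPrism.connected
      hasTriangularEmbedding_cappedPrism.card_edgeSet
  have hinj : Function.Injective (![6, 7, 8] : Fin 3 → Fin 9) := by decide
  have hcard (k : ℕ) (hk : 5 ≤ k) : Nat.card (TowerVertex (Fin 9) (k - 3)) = 3 * k := by
    rw [natCard_towerVertex, Nat.card_fin]
    omega
  refine ⟨⟨hA.isTriangulation, connectedDominationNumber_nestedTriangles, hA.isFacialTriangle,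
      fun k hk => ⟨hcard k hk, (hA.octahedronTower _).isTriangulation, ?_⟩⟩,
    ⟨hasTriangularEmbedding_cappedPrism.isTriangulation, connectedDominationNumber_cappedPrism,
      ⟨_, hasTriangularEmbedding_cappedPrism.isFacialTriangle⟩,
      fun t ht k hk => ⟨hcard k hk, ((hP ht).octahedronTower _).isTriangulation, ?_⟩⟩,
    fun t _ k _ => ⟨fun e => ?_⟩⟩
  · rw [connectedDominationNumber_octahedronTower noDominatingPair_nestedTriangles hinj
      ⟨_, isConnectedDominatingSet_nestedTriangles', rfl, 0, by decide⟩ (by omega)]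
    omega
  · obtain ⟨θ, -, hface⟩ := (hP ht).exists_apexMap
    rw [connectedDominationNumber_octahedronTower
      (noDominatingPair_cappedPrism fun i => (hface i).1) hface.injective
      (exists_isConnectedDominatingSet_cappedPrism (hface 0).1) (by omega)]
    omega
  · obtain ⟨v, -, hodd⟩ := exists_odd_ncard_neighborSet_octahedronTower
      (exists_odd_ncard_neighborSet_cappedPrism t) (k - 3)
    have heven := even_ncard_neighborSet_octahedronTower hinj
      even_ncard_neighborSet_nestedTriangles (k - 3) (e.symm v)
    rw [e.symm.ncard_neighborSet] at heven
    exact Nat.not_even_iff_odd.2 hodd heven
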